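/- For $k\in\mathbb{Z}_{>0}$ and $a\in\mathbb{Z}+\frac{k}{2}$, $a\ge 0$, a $(k,a)$-colored F-partition is a two-rowed array $$\begin{pmatrix} a_1 & a_2 & \cdots & a_r\\ b_1 & b_2 & \cdots & b_s\end{pmatrix}$$ whose entries are taken from $k$ copies (colors) of the nonnegative integers, such that each row is strictly decreasing for the lexicographic order ($m$ in the $j$-th copy is smaller than $n$ in the $\ell$-th copy exactly when $m<n$, or $m=n$ and $j<\ell$), where $(r,s)\neq(0,0)$ is a pair of nonnegative integers with $r-s=a-\frac{k}{2}$. Its weight is $r+\sum_{\ell=1}^{r}a_\ell+\sum_{j=1}^{s}b_j$, where entries are added as integers. Let $c\psi_{k,a}(n)$ denote the (finite) number of $(k,a)$-colored F-partitions of weight $n$. Then for every integer $n\ge 0$: $$c\psi_{4,0}(2n+1)\equiv 0 \pmod{32},\qquad c\psi_{4,0}(4n+3)\equiv 0 \pmod{64},\qquad c\psi_{4,1}(n)\equiv 0 \pmod{4}.$$ -/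

import Mathlib

/-- One of `k` copies of the nonnegative integers each: `toLex (m, j)` is the integer `m` in the
`j`-th copy. The order is lexicographic, first by value and then by copy (colour). -/
abbrev ColoredNat (k : ℕ) : Type := ℕ ×ₗ Fin k

/-- The integer underlying a coloured integer. -/
def ColoredNat.value {k : ℕ} (x : ColoredNat k) : ℕ := (ofLex x).1

/-- A `(k, a)`-coloured F-partition: a two-rowed array `(a₁ … a_r ; b₁ … b_s)` of integers from
`k` copies of the nonnegative integers, each row strictly decreasing for the lexicographic order,
with `(r, s) ≠ (0, 0)` and `r - s = a - k / 2`. -/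
structure FPartition (k : ℕ) (a : ℚ) : Type where
  top : List (ColoredNat k)
  bottom : List (ColoredNat k)
  top_decreasing : top.Pairwise (· > ·)
  bottom_decreasing : bottom.Pairwise (· > ·)
  lengths_ne : (top.length, bottom.length) ≠ (0, 0)
  lengths_sub : (top.length : ℚ) - (bottom.length : ℚ) = a - (k : ℚ) / 2

/-- The weight `r + ∑ a_ℓ + ∑ b_j`. -/
def FPartition.weight {k : ℕ} {a : ℚ} (P : FPartition k a) : ℕ :=
  P.top.length + (P.top.map ColoredNat.value).sum + (P.bottom.map ColoredNat.value).sum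

/-- `cpsi k a n` is the number of `(k, a)`-coloured F-partitions of weight `n`
(a finite number, see `FPartition.finite_weight_eq`). -/
noncomputable def cpsi (k : ℕ) (a : ℚ) (n : ℕ) : ℕ :=
  Nat.card {P : FPartition k a // P.weight = n}

/-- There are only finitely many `(k, a)`-coloured F-partitions of a given weight. -/
theorem FPartition.finite_weight_eq (k : ℕ) (a : ℚ) (n : ℕ) :
    Finite {P : FPartition k a // P.weight = n} := by
  have hle : ∀ (l : List (ColoredNat k)), ∀ x ∈ l,
      x.value ≤ (l.map ColoredNat.value).sum := fun l x hx =>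
    List.single_le_sum (by simp) _ (List.mem_map_of_mem hx)
  have hS : {x : ColoredNat k | x.value ≤ n}.Finite := by
    refine ((Set.finite_Iic n).prod (Set.finite_univ (α := Fin k))).preimage
      (f := fun x : ColoredNat k => ofLex x) (ofLex.injective.injOn) |>.subset ?_
    intro x hx
    exact ⟨hx, Set.mem_univ _⟩
  have hfin : Finite {x : ColoredNat k // x.value ≤ n} := hS
  have inj : ∀ l₁ l₂ : List (ColoredNat k), l₁.Pairwise (· > ·) → l₂.Pairwise (· > ·) →
      (∀ x, x ∈ l₁ ↔ x ∈ l₂) → l₁ = l₂ := by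
    intro l₁ l₂ h₁ h₂ h
    have n₁ : l₁.Nodup := h₁.imp (fun h => h.ne')
    have n₂ : l₂.Nodup := h₂.imp (fun h => h.ne')
    exact ((List.perm_ext_iff_of_nodup n₁ n₂).2 h).eq_of_pairwise
      (fun x y _ _ hxy hyx => absurd hxy (lt_asymm hyx)) h₁ h₂
  refine Finite.of_injective
    (β := Set {x : ColoredNat k // x.value ≤ n} × Set {x : ColoredNat k // x.value ≤ n})
    (fun P => ({x | x.1 ∈ P.1.top}, {x | x.1 ∈ P.1.bottom})) ?_
  rintro ⟨⟨t, b, ht, hb, hne, hs⟩, hw⟩ ⟨⟨t', b', ht', hb', hne', hs'⟩, hw'⟩ h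
  simp only [FPartition.weight] at hw hw'
  simp only [Prod.mk.injEq, Set.ext_iff, Set.mem_ofPred_eq, Subtype.forall] at h
  have e₁ : t = t' := inj t t' ht ht' fun x =>
    ⟨fun hx => (h.1 x (by have := hle t x hx; omega)).1 hx,
     fun hx => (h.1 x (by have := hle t' x hx; omega)).2 hx⟩
  have e₂ : b = b' := inj b b' hb hb' fun x =>
    ⟨fun hx => (h.2 x (by have := hle b x hx; omega)).1 hx,
     fun hx => (h.2 x (by have := hle b' x hx; omega)).2 hx⟩
  subst e₁ e₂
  rfl

/-! Write `P` for `neutralSeries`, `φ`, `ψ` for `thetaPhi`, `thetaPsi`, and `f(q^2)` for `expand 2 _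
f`. The entries of one colour form a set of particles (top row) and a set of holes (bottom row).
Shifting to charge zero identifies such a state with an integer `m` and a neutral state, at energy
cost `m(m+1)/2`. Hence (`FPartition.mk_cpsi`) the generating function is `P^k` times a theta series
over integer vectors with sum `c = a - k/2`.

For `k = 4`, `c = -1` the theta series is `4ψ(q)φ(q)ψ(q^2)`, which gives the divisibility by 4. For
`c = -2` it is `2ψ(q^4)φ(q)^2 + 4φ(q^2)ψ(q^2)^2`. The identities `P = P(q^2)^2 ψ`, `ψ^2 = φ ψ(q^2)`
and `φ^2 = φ(q^2)^2 + 4qψ(q^4)^2`, all proved by bijections, split the product by parity of the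
exponent: the odd part is 32 times a square times a theta series (`mk_cpsi_four_zero`). In terms of
`q^2` that theta series is even, and a square has even coefficients at odd exponents, whence 64. -/

open PowerSeries

/-! ### Generating functions of integer weights -/

/-- A weight with nonnegative values and finite sublevel sets. -/
structure IsProperWeight {ι : Type} (w : ι → ℤ) : Prop where
  nonneg : ∀ i, 0 ≤ w i
  finite_le : ∀ n : ℤ, {i | w i ≤ n}.Finite

/-- The generating function `∑ i, X ^ w i` of a weight. -/
noncomputable def weightSeries {ι : Type} (w : ι → ℤ) : ℤ⟦X⟧ :=
  PowerSeries.mk fun n => (Nat.card {i // w i = (n : ℤ)} : ℤ)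

theorem IsProperWeight.finite_eq {ι : Type} {w : ι → ℤ} (hw : IsProperWeight w) (n : ℤ) :
    Finite {i // w i = n} :=
  ((hw.finite_le n).subset fun _ hi => le_of_eq hi : {i | w i = n}.Finite)

theorem IsProperWeight.comp_injective {ι κ : Type} {w : ι → ℤ} (hw : IsProperWeight w)
    {f : κ → ι} (hf : f.Injective) : IsProperWeight (fun i => w (f i)) :=
  ⟨fun _ => hw.nonneg _, fun n =>
    Set.Finite.preimage (f := f) (s := {i | w i ≤ n}) hf.injOn (hw.finite_le n)⟩

theorem IsProperWeight.prod {ι κ : Type} {w : ι → ℤ} {v : κ → ℤ} (hw : IsProperWeight w)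
    (hv : IsProperWeight v) : IsProperWeight (fun p : ι × κ => w p.1 + v p.2) := by
  refine ⟨fun p => add_nonneg (hw.nonneg _) (hv.nonneg _), fun n => ?_⟩
  refine ((hw.finite_le n).prod (hv.finite_le n)).subset fun p hp => ?_
  have h₁ := hw.nonneg p.1
  have h₂ := hv.nonneg p.2
  simp only [Set.mem_ofPred_eq] at hp
  constructor <;> simp only [Set.mem_ofPred_eq] <;> linarith

theorem IsProperWeight.pi {ι : Type} {w : ι → ℤ} (hw : IsProperWeight w) (k : ℕ) :
    IsProperWeight (fun p : Fin k → ι => ∑ j, w (p j)) := by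
  refine ⟨fun p => Finset.sum_nonneg fun _ _ => hw.nonneg _, fun n => ?_⟩
  refine (Set.Finite.pi' fun _ : Fin k => hw.finite_le n).subset fun p hp j => ?_
  exact (Finset.single_le_sum (f := fun j => w (p j)) (fun _ _ => hw.nonneg _)
    (Finset.mem_univ j)).trans hp

/-- The slack `-1` is needed for `m(m+1)/2`, which vanishes at `m = -1`. -/
theorem isProperWeight_int {w : ℤ → ℤ} (h0 : ∀ m, 0 ≤ w m) (h : ∀ m, |m| - 1 ≤ w m) :
    IsProperWeight w := by
  refine ⟨h0, fun n => (Set.finite_Icc (-(n + 1)) (n + 1)).subset fun m hm => ?_⟩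
  have := h m
  simp only [Set.mem_ofPred_eq] at hm
  exact Set.mem_Icc.2 (abs_le.1 (by linarith))

theorem weightSeries_eq_of_bijective {ι κ : Type} {w : ι → ℤ} {v : κ → ℤ} (f : ι → κ)
    (hf : f.Bijective) (h : ∀ i, v (f i) = w i) : weightSeries w = weightSeries v := by
  ext n
  simp only [weightSeries, coeff_mk, Nat.cast_inj]
  exact Nat.card_congr ((Equiv.ofBijective f hf).subtypeEquiv fun i => by
    simp [h])

theorem weightSeries_prod {ι κ : Type} {w : ι → ℤ} {v : κ → ℤ} (hw : IsProperWeight w)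
    (hv : IsProperWeight v) :
    weightSeries (fun p : ι × κ => w p.1 + v p.2) = weightSeries w * weightSeries v := by
  ext n
  simp only [weightSeries, coeff_mk, coeff_mul]
  have := fun n : ℤ => hw.finite_eq n
  have := fun n : ℤ => hv.finite_eq n
  let F : (Σ c : Finset.HasAntidiagonal.antidiagonal n, {i // w i = (c.1.1 : ℤ)} × {j // v j = (c.1.2 : ℤ)}) →
      {p : ι × κ // w p.1 + v p.2 = n} := fun x => ⟨(x.2.1.1, x.2.2.1), by
    have := Finset.HasAntidiagonal.mem_antidiagonal.1 x.1.2
    simp only [x.2.1.2, x.2.2.2]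
    exact_mod_cast this⟩
  have hF : F.Bijective := by
    constructor
    · rintro ⟨⟨⟨a, b⟩, hc⟩, ⟨i, hi⟩, ⟨j, hj⟩⟩ ⟨⟨⟨a', b'⟩, hc'⟩, ⟨i', hi'⟩, ⟨j', hj'⟩⟩ h
      simp only [F, Subtype.mk.injEq, Prod.mk.injEq] at h
      obtain ⟨rfl, rfl⟩ := h
      simp only at hi hj hi' hj'
      obtain rfl : a = a' := by exact_mod_cast hi.symm.trans hi'
      obtain rfl : b = b' := by exact_mod_cast hj.symm.trans hj'
      rfl
    · rintro ⟨⟨i, j⟩, h⟩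
      obtain ⟨a, ha⟩ := Int.eq_ofNat_of_zero_le (hw.nonneg i)
      obtain ⟨b, hb⟩ := Int.eq_ofNat_of_zero_le (hv.nonneg j)
      refine ⟨⟨⟨(a, b), ?_⟩, ⟨i, ha⟩, ⟨j, hb⟩⟩, rfl⟩
      simp only [ha, hb] at h
      exact Finset.HasAntidiagonal.mem_antidiagonal.2 (by exact_mod_cast h)
  -- Finite fibres matter here: `Nat.card` is 0 on infinite types.
  rw [← Nat.card_congr (Equiv.ofBijective F hF), Nat.card_sigma]
  simp only [Nat.card_prod, Nat.cast_sum, Nat.cast_mul]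
  exact Finset.sum_coe_sort (Finset.HasAntidiagonal.antidiagonal n) fun c =>
    (Nat.card {i // w i = (c.1 : ℤ)} : ℤ) * (Nat.card {j // v j = (c.2 : ℤ)} : ℤ)

theorem weightSeries_sum {ι κ : Type} {w : ι → ℤ} {v : κ → ℤ} (hw : IsProperWeight w)
    (hv : IsProperWeight v) :
    weightSeries (Sum.elim w v) = weightSeries w + weightSeries v := by
  ext n
  have := fun n : ℤ => hw.finite_eq n
  have := fun n : ℤ => hv.finite_eq n
  simp only [weightSeries, coeff_mk, map_add]
  have e : Nat.card {x // Sum.elim w v x = (n : ℤ)} =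
      Nat.card ({i // w i = (n : ℤ)} ⊕ {j // v j = (n : ℤ)}) :=
    Nat.card_congr Equiv.subtypeSum
  rw [e, Nat.card_sum, Nat.cast_add]

theorem weightSeries_pi {ι : Type} {w : ι → ℤ} (hw : IsProperWeight w) (k : ℕ) :
    weightSeries (fun p : Fin k → ι => ∑ j, w (p j)) = weightSeries w ^ k := by
  induction k with
  | zero =>
    ext n
    simp only [weightSeries, coeff_mk, Finset.univ_eq_empty, Finset.sum_empty, pow_zero,
      coeff_one]
    by_cases hn : n = 0
    · subst hn; simp
    · have : IsEmpty {_p : Fin 0 → ι // (0 : ℤ) = n} := ⟨fun p => hn (by exact_mod_cast p.2.symm)⟩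
      simp [hn]
  | succ k ih =>
    rw [pow_succ', ← ih, ← weightSeries_prod hw (hw.pi k)]
    refine (weightSeries_eq_of_bijective (Fin.consEquiv fun _ => ι) (Equiv.bijective _) ?_).symm
    intro p
    simp [Fin.consEquiv, Fin.sum_univ_succ]

theorem weightSeries_mul_left {ι : Type} (w : ι → ℤ) (k : ℕ) (hk : k ≠ 0) :
    weightSeries (fun i => (k : ℤ) * w i) = expand k hk (weightSeries w) := by
  ext n
  by_cases h : k ∣ n
  · obtain ⟨m, rfl⟩ := h
    rw [coeff_expand_mul]
    simp only [weightSeries, coeff_mk, Nat.cast_mul]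
    simp [hk]
  · rw [coeff_expand_of_not_dvd k hk _ h]
    have : IsEmpty {i // (k : ℤ) * w i = n} :=
      ⟨fun i => h (Int.natCast_dvd_natCast.1 ⟨_, i.2.symm⟩)⟩
    simp [weightSeries]

theorem weightSeries_add_one {ι : Type} {w : ι → ℤ} (hw : ∀ i, 0 ≤ w i) :
    weightSeries (fun i => w i + 1) = X * weightSeries w := by
  ext n
  cases n with
  | zero =>
    have : IsEmpty {i // w i + 1 = ((0 : ℕ) : ℤ)} := ⟨fun i => by
      have := hw i.1; have := i.2; push_cast at this; omega⟩
    rw [coeff_zero_X_mul]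
    simp only [weightSeries, coeff_mk, Nat.card_of_isEmpty, Nat.cast_zero]
  | succ n =>
    rw [coeff_succ_X_mul]
    simp [weightSeries]

/-! ### Charged states: shift and interleaving -/

/-- A pair of finite sets of naturals: particles and holes. -/
abbrev ChargedState : Type := Finset ℕ × Finset ℕ

namespace ChargedState

/-- The number of particles minus the number of holes. -/
def charge (d : ChargedState) : ℤ := d.1.card - d.2.card

/-- The weight that a colour contributes to an F-partition. -/
def energy (d : ChargedState) : ℤ := ∑ x ∈ d.1, ((x : ℤ) + 1) + ∑ x ∈ d.2, (x : ℤ)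

theorem isProperWeight_energy : IsProperWeight energy := by
  have h1 : ∀ d : ChargedState, 0 ≤ ∑ x ∈ d.1, ((x : ℤ) + 1) :=
    fun d => Finset.sum_nonneg fun _ _ => by positivity
  have h2 : ∀ d : ChargedState, 0 ≤ ∑ x ∈ d.2, (x : ℤ) :=
    fun d => Finset.sum_nonneg fun _ _ => by positivity
  refine ⟨fun d => add_nonneg (h1 d) (h2 d), fun n => ?_⟩
  refine (((Finset.range (n.toNat + 1)).powerset ×ˢ
    (Finset.range (n.toNat + 1)).powerset).finite_toSet).subset fun d hd => ?_
  simp only [Set.mem_ofPred_eq, energy] at hd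
  simp only [Finset.mem_coe, Finset.mem_product, Finset.mem_powerset]
  have := h1 d
  have := h2 d
  constructor <;> intro x hx <;> rw [Finset.mem_range]
  · have := Finset.single_le_sum (f := fun x : ℕ => (x : ℤ) + 1) (fun _ _ => by positivity) hx
    omega
  · have := Finset.single_le_sum (f := fun x : ℕ => (x : ℤ)) (fun _ _ => by positivity) hx
    omega

/-- Move every particle one step up, filling the topmost hole position. -/
noncomputable def raise (d : ChargedState) : ChargedState :=
  (if 0 ∈ d.2 then d.1.image (· + 1) else insert 0 (d.1.image (· + 1)),
    d.2.preimage (· + 1) (add_left_injective 1).injOn)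

theorem zero_notMem_image_succ (s : Finset ℕ) : 0 ∉ s.image (· + 1) := by simp

theorem raise_snd_eq (s : Finset ℕ) :
    (s.preimage (· + 1) (add_left_injective 1).injOn).image (· + 1) = s.erase 0 := by
  ext x
  cases x <;> simp

theorem card_image_succ (s : Finset ℕ) : (s.image (· + 1)).card = s.card :=
  Finset.card_image_of_injective _ (add_left_injective 1)

theorem sum_image_succ (s : Finset ℕ) (f : ℕ → ℤ) :
    ∑ x ∈ s.image (· + 1), f x = ∑ x ∈ s, f (x + 1) :=
  Finset.sum_image (add_left_injective 1).injOn

theorem charge_raise (d : ChargedState) : (raise d).charge = d.charge + 1 := by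
  have h := card_image_succ (d.2.preimage (· + 1) (add_left_injective 1).injOn)
  rw [raise_snd_eq] at h
  simp only [charge, raise]
  rw [← h]
  by_cases h0 : 0 ∈ d.2
  · have := Finset.card_erase_add_one h0
    rw [if_pos h0, card_image_succ]
    omega
  · rw [if_neg h0, Finset.card_insert_of_notMem (zero_notMem_image_succ _), card_image_succ,
      Finset.erase_eq_of_notMem h0]
    push_cast; ring

/-- Each particle gains 1 and each hole loses 1, except that a hole at 0 disappears at no gain; if
there is none, a new particle of energy 1 appears. Both cases add `charge + 1`. -/
theorem energy_raise (d : ChargedState) : (raise d).energy = d.energy + d.charge + 1 := by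
  have h := charge_raise d
  have e := sum_image_succ (d.2.preimage (· + 1) (add_left_injective 1).injOn) fun x => (x : ℤ)
  rw [raise_snd_eq, Finset.sum_erase _ (by simp)] at e
  simp only [charge] at h
  simp only [energy, charge]
  have e2 : ∑ x ∈ (raise d).1, ((x : ℤ) + 1) = ∑ x ∈ d.1, ((x : ℤ) + 1) + (raise d).1.card := by
    simp only [raise]
    split_ifs
    · rw [sum_image_succ, card_image_succ]
      simp [Finset.sum_add_distrib]
    · rw [Finset.card_insert_of_notMem (zero_notMem_image_succ _),
        Finset.sum_insert (zero_notMem_image_succ _), sum_image_succ, card_image_succ]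
      simp [Finset.sum_add_distrib]
      ring
  rw [e2, e]
  simp only [Nat.cast_add, Nat.cast_one, Finset.sum_add_distrib, Finset.sum_const, nsmul_eq_mul,
    mul_one]
  have : ((raise d).2.card : ℤ) =
    ((d.2.preimage (· + 1) (add_left_injective 1).injOn).card : ℤ) := rfl
  have : ∑ x ∈ (raise d).2, (x : ℤ) =
    ∑ x ∈ (d.2.preimage (· + 1) (add_left_injective 1).injOn), (x : ℤ) := rfl
  linarith

/-- Exchanging particles and holes reflects the line of positions, so it conjugates the upward shift
to the downward one. -/
theorem swap_raise_swap_raise (d : ChargedState) : (raise (raise d).swap).swap = d := by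
  obtain ⟨s, t⟩ := d
  simp only [raise, Prod.swap_prod_mk, raise_snd_eq]
  ext x
  · by_cases h : 0 ∈ t <;> cases x <;> simp [h]
  · by_cases h : 0 ∈ t <;> cases x <;> simp [h]

/-- `raise` as a permutation. -/
noncomputable def raiseEquiv : Equiv.Perm ChargedState where
  toFun := raise
  invFun d := (raise d.swap).swap
  left_inv := swap_raise_swap_raise
  right_inv d := by
    have := congrArg Prod.swap (swap_raise_swap_raise d.swap)
    simpa using this

theorem charge_energy_zpow_raise (d : ChargedState) (m : ℤ) :
    ((raiseEquiv ^ m) d).charge = d.charge + m ∧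
      2 * ((raiseEquiv ^ m) d).energy = 2 * (d.energy + m * d.charge) + m * (m + 1) := by
  have step : ∀ i : ℤ, (raiseEquiv ^ (i + 1)) d = raise ((raiseEquiv ^ i) d) := fun i => by
    rw [add_comm, zpow_add, zpow_one, Equiv.Perm.mul_apply]; rfl
  induction m using Int.induction_on with
  | zero => simp
  | succ i ih =>
    rw [step, charge_raise, energy_raise]
    constructor
    · linarith [ih.1]
    · linear_combination ih.2 + 2 * ih.1
  | pred i ih =>
    have h := step (-(i : ℤ) - 1)
    rw [sub_add_cancel] at h
    rw [h, charge_raise, energy_raise] at ih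
    constructor
    · linarith [ih.1]
    · linear_combination ih.2 - 2 * ih.1

/-- States of charge zero. -/
abbrev Neutral : Type := {d : ChargedState // d.charge = 0}

/-- The state of charge `m` obtained from a neutral state by moving all particles up by `m`. -/
noncomputable def lift (p : ℤ × Neutral) : ChargedState := (raiseEquiv ^ p.1) p.2.1

theorem charge_lift (p : ℤ × Neutral) : (lift p).charge = p.1 := by
  simp [lift, (charge_energy_zpow_raise _ _).1, p.2.2]

theorem energy_lift (p : ℤ × Neutral) :
    (lift p).energy = p.1 * (p.1 + 1) / 2 + p.2.1.energy := by
  have := (charge_energy_zpow_raise p.2.1 p.1).2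
  rw [p.2.2] at this
  have h : p.1 * (p.1 + 1) = 2 * ((lift p).energy - p.2.1.energy) := by
    simp only [lift]; linarith
  rw [h, Int.mul_ediv_cancel_left _ two_ne_zero]
  ring

theorem bijective_lift : Function.Bijective lift := by
  constructor
  · rintro ⟨m, d⟩ ⟨m', d'⟩ h
    have hm := congrArg charge h
    rw [charge_lift, charge_lift] at hm
    simp only at hm
    subst hm
    exact congrArg (Prod.mk m) (Subtype.ext ((raiseEquiv ^ m).injective h))
  · intro d
    refine ⟨(d.charge, ⟨(raiseEquiv ^ (-d.charge)) d, ?_⟩), ?_⟩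
    · rw [(charge_energy_zpow_raise _ _).1]; ring
    · simp only [lift]
      rw [← Equiv.Perm.mul_apply, ← zpow_add, add_neg_cancel, zpow_zero, Equiv.Perm.one_apply]

/-- The states whose particles are `2x + 1`, `2y` and holes `2x`, `2y + 1` for the particles and
holes `x` of the first and `y` of the second given state. -/
def interleave (p : ChargedState × ChargedState) : ChargedState :=
  ((p.2.1.disjSum p.1.1).map Equiv.natSumNatEquivNat.toEmbedding,
    (p.1.2.disjSum p.2.2).map Equiv.natSumNatEquivNat.toEmbedding)

theorem charge_interleave (p : ChargedState × ChargedState) :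
    (interleave p).charge = p.1.charge + p.2.charge := by
  simp [interleave, charge]; ring

/-- With particle `x` at position `x` and hole `x` at position `-1 - x`, the first state occupies
the odd positions and the second the even ones. Each particle of the second state costs one unit
less than double, each of its holes one more. -/
theorem energy_interleave (p : ChargedState × ChargedState) :
    (interleave p).energy = 2 * p.1.energy + 2 * p.2.energy - p.2.charge := by
  simp [interleave, charge, energy, Finset.sum_disjSum, Finset.sum_add_distrib, ← Finset.mul_sum]
  ring

theorem bijective_interleave : Function.Bijective interleave := by
  let e := (Finset.sumEquiv (α := ℕ) (β := ℕ)).symm.toEquiv.trans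
    Equiv.natSumNatEquivNat.finsetCongr
  constructor
  · rintro ⟨⟨a, b⟩, ⟨c, d⟩⟩ ⟨⟨a', b'⟩, ⟨c', d'⟩⟩ h
    have h1 := e.injective (a₁ := (c, a)) (a₂ := (c', a')) (congrArg Prod.fst h)
    have h2 := e.injective (a₁ := (b, d)) (a₂ := (b', d')) (congrArg Prod.snd h)
    simp only [Prod.mk.injEq] at h1 h2
    obtain ⟨⟨rfl, rfl⟩, rfl, rfl⟩ := And.intro h1 h2
    rfl
  · rintro ⟨s, t⟩
    obtain ⟨⟨c, a⟩, rfl⟩ := e.surjective s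
    obtain ⟨⟨b, d⟩, rfl⟩ := e.surjective t
    exact ⟨((a, b), (c, d)), rfl⟩

end ChargedState

/-! ### Theta series and their identities -/

theorem Int.two_mul_mul_succ_ediv_two (m : ℤ) : 2 * (m * (m + 1) / 2) = m * (m + 1) :=
  Int.mul_ediv_cancel' (Int.even_mul_succ_self m).two_dvd

theorem isProperWeight_mul_succ_ediv_two : IsProperWeight fun m : ℤ => m * (m + 1) / 2 := by
  refine isProperWeight_int (fun m => ?_) fun m => ?_
  · have := Int.two_mul_mul_succ_ediv_two m
    rcases le_or_gt 0 m with h | h <;> nlinarith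
  · have := Int.two_mul_mul_succ_ediv_two m
    rcases le_or_gt 0 m with h | h
    · rw [abs_of_nonneg h]; nlinarith [sq_nonneg (m - 1)]
    · rw [abs_of_neg h]
      have : 0 ≤ (m + 1) * (m + 2) := by
        rcases le_or_gt m (-2) with h | h
        · nlinarith
        · obtain rfl : m = -1 := by omega
          norm_num
      nlinarith

/-- The generating function of neutral states by energy. -/
noncomputable def neutralSeries : ℤ⟦X⟧ :=
  weightSeries fun d : ChargedState.Neutral => d.1.energy

theorem isProperWeight_neutral : IsProperWeight fun d : ChargedState.Neutral => d.1.energy :=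
  ChargedState.isProperWeight_energy.comp_injective Subtype.val_injective

/-- The theta series `∑ X ^ (m ^ 2)`. -/
noncomputable def thetaPhi : ℤ⟦X⟧ := weightSeries fun m : ℤ => m ^ 2

/-- The theta series `∑ X ^ (2 m ^ 2 - m)` of the triangular numbers. -/
noncomputable def thetaPsi : ℤ⟦X⟧ := weightSeries fun m : ℤ => 2 * m ^ 2 - m

theorem isProperWeight_sq : IsProperWeight fun m : ℤ => m ^ 2 := by
  refine isProperWeight_int (fun m => sq_nonneg m) fun m => ?_
  rw [← sq_abs]
  nlinarith [abs_nonneg m]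

theorem isProperWeight_two_mul_sq_sub : IsProperWeight fun m : ℤ => 2 * m ^ 2 - m := by
  have h : ∀ m : ℤ, |m| ≤ m ^ 2 := fun m => by
    rw [← sq_abs]
    rcases (abs_nonneg m).eq_or_lt with h | h
    · rw [← h]; norm_num
    · nlinarith
  refine isProperWeight_int (fun m => ?_) fun m => ?_
  · nlinarith [h m, le_abs_self m, sq_nonneg m]
  · nlinarith [h m, le_abs_self m, sq_nonneg m]

theorem IsProperWeight.const_mul {ι : Type} {w : ι → ℤ} (hw : IsProperWeight w) {k : ℤ}
    (hk : 1 ≤ k) : IsProperWeight (fun i => k * w i) := by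
  refine ⟨fun i => mul_nonneg (by omega) (hw.nonneg i), fun n =>
    (hw.finite_le n).subset fun i hi => ?_⟩
  have := hw.nonneg i
  simp only [Set.mem_ofPred_eq] at hi ⊢
  nlinarith

/-- Splitting a neutral state by parity of position gives states of charges `-m` and `m`, with shift
cost `m(m-1) + m(m+1) - m = 2m^2 - m`. -/
theorem neutralSeries_eq :
    neutralSeries = expand 2 two_ne_zero neutralSeries ^ 2 * thetaPsi := by
  have hw := isProperWeight_neutral.const_mul (k := 2) (by norm_num)
  have e := weightSeries_mul_left (fun d : ChargedState.Neutral => d.1.energy) 2 two_ne_zero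
  rw [neutralSeries, ← e, sq, Nat.cast_ofNat, ← weightSeries_prod hw hw, thetaPsi,
    ← weightSeries_prod (hw.prod hw) isProperWeight_two_mul_sq_sub]
  let F : (ChargedState.Neutral × ChargedState.Neutral) × ℤ → ChargedState.Neutral :=
    fun p => ⟨ChargedState.interleave
      (ChargedState.lift (-p.2, p.1.1), ChargedState.lift (p.2, p.1.2)), by
        simp [ChargedState.charge_interleave, ChargedState.charge_lift]⟩
  refine (weightSeries_eq_of_bijective F ⟨?_, ?_⟩ ?_).symm
  · rintro ⟨⟨a, b⟩, m⟩ ⟨⟨a', b'⟩, m'⟩ h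
    have h := ChargedState.bijective_interleave.1 (congrArg Subtype.val h)
    have h1 := ChargedState.bijective_lift.1 (congrArg Prod.fst h)
    have h2 := ChargedState.bijective_lift.1 (congrArg Prod.snd h)
    simp only [Prod.mk.injEq] at h1 h2 ⊢
    exact ⟨⟨h1.2, h2.2⟩, h2.1⟩
  · rintro ⟨d, hd⟩
    obtain ⟨⟨d₁, d₂⟩, rfl⟩ := ChargedState.bijective_interleave.2 d
    obtain ⟨⟨m, a⟩, rfl⟩ := ChargedState.bijective_lift.2 d₁
    obtain ⟨⟨n, b⟩, rfl⟩ := ChargedState.bijective_lift.2 d₂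
    simp only [ChargedState.charge_interleave, ChargedState.charge_lift] at hd
    obtain rfl : m = -n := by omega
    exact ⟨((a, b), n), rfl⟩
  · rintro ⟨⟨a, b⟩, m⟩
    simp only [F, ChargedState.energy_interleave, ChargedState.energy_lift,
      ChargedState.charge_lift]
    have h1 := Int.two_mul_mul_succ_ediv_two (-m)
    have h2 := Int.two_mul_mul_succ_ediv_two m
    linear_combination h1 + h2

theorem thetaPsi_sq : thetaPsi ^ 2 = thetaPhi * expand 2 two_ne_zero thetaPsi := by
  have h := isProperWeight_two_mul_sq_sub
  have e := weightSeries_mul_left (fun m : ℤ => 2 * m ^ 2 - m) 2 two_ne_zero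
  rw [thetaPsi, ← e, sq, Nat.cast_ofNat, ← weightSeries_prod h h, thetaPhi,
    ← weightSeries_prod isProperWeight_sq (h.const_mul (k := 2) (by norm_num))]
  -- Completing squares, `(4m-1)^2 + (4n-1)^2 = 2((2(m+n)-1)^2 + (2(m-n))^2)`. Take `s = m - n` and
  -- `2(m+n) - 1 = ±(4t - 1)`, the sign being decided by the parity of `s`.
  let F : ℤ × ℤ → ℤ × ℤ := fun p =>
    if p.1 % 2 = 0 then (p.2 + p.1 / 2, p.2 - p.1 / 2)
    else (p.1 / 2 + 1 - p.2, - p.2 - p.1 / 2)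
  refine (weightSeries_eq_of_bijective F ⟨?_, ?_⟩ ?_).symm
  · rintro ⟨s, t⟩ ⟨s', t'⟩ h
    simp only [F] at h
    split_ifs at h <;> simp only [Prod.mk.injEq] at h ⊢ <;> omega
  · rintro ⟨m, n⟩
    rcases Int.emod_two_eq_zero_or_one (m + n) with h | h
    · refine ⟨(m - n, (m + n) / 2), ?_⟩
      simp only [F]
      rw [if_pos (by omega)]
      simp only [Prod.mk.injEq]; omega
    · refine ⟨(m - n, (1 - m - n) / 2), ?_⟩
      simp only [F]
      rw [if_neg (by omega)]
      simp only [Prod.mk.injEq]; omega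
  · rintro ⟨s, t⟩
    simp only [F]
    split_ifs with h
    · obtain ⟨u, rfl⟩ : ∃ u, s = 2 * u := ⟨s / 2, by omega⟩
      rw [Int.mul_ediv_cancel_left _ two_ne_zero]
      ring
    · obtain ⟨u, rfl⟩ : ∃ u, s = 2 * u + 1 := ⟨s / 2, by omega⟩
      rw [show (2 * u + 1) / 2 = u by omega]
      ring

/-- The involution `m ↦ -1 - m` preserves the weight and swaps parities; each parity class
contributes one copy of `ψ(q^2)`. -/
theorem weightSeries_sq_add :
    weightSeries (fun m : ℤ => m ^ 2 + m) = 2 * expand 2 two_ne_zero thetaPsi := by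
  have h := isProperWeight_two_mul_sq_sub.const_mul (k := 2) (by norm_num)
  rw [thetaPsi, ← weightSeries_mul_left, Nat.cast_ofNat, two_mul, ← weightSeries_sum h h]
  refine (weightSeries_eq_of_bijective (Sum.elim (fun j => 2 * j - 1) fun j => -2 * j)
    ⟨?_, ?_⟩ ?_).symm
  · rintro (i | i) (j | j) h <;> simp only [Sum.elim_inl, Sum.elim_inr] at h
    · congr 1; omega
    · omega
    · omega
    · congr 1; omega
  · intro m
    rcases Int.emod_two_eq_zero_or_one m with h | h
    · exact ⟨.inr (-m / 2), by simp only [Sum.elim_inr]; omega⟩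
    · exact ⟨.inl ((m + 1) / 2), by simp only [Sum.elim_inl]; omega⟩
  · rintro (i | i) <;> simp only [Sum.elim_inl, Sum.elim_inr] <;> ring

theorem isProperWeight_sq_add : IsProperWeight fun m : ℤ => m ^ 2 + m := by
  convert isProperWeight_mul_succ_ediv_two.const_mul (k := 2) (by norm_num) using 2 with m
  rw [Int.two_mul_mul_succ_ediv_two]
  ring

theorem thetaPhi_sq : thetaPhi ^ 2 = expand 2 two_ne_zero thetaPhi ^ 2 +
    4 * X * expand 2 two_ne_zero (expand 2 two_ne_zero thetaPsi) ^ 2 := by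
  have h := isProperWeight_sq
  have h2 := h.const_mul (k := 2) (by norm_num)
  have h3 := isProperWeight_sq_add.const_mul (k := 2) (by norm_num)
  have h4 := h3.prod h3
  have e : 4 * X * expand 2 two_ne_zero (expand 2 two_ne_zero thetaPsi) ^ 2 =
      X * (expand 2 two_ne_zero (2 * expand 2 two_ne_zero thetaPsi) *
        expand 2 two_ne_zero (2 * expand 2 two_ne_zero thetaPsi)) := by
    rw [map_mul, map_ofNat]; ring
  rw [e, ← weightSeries_sq_add, thetaPhi, ← weightSeries_mul_left, ← weightSeries_mul_left,
    sq, sq, Nat.cast_ofNat, ← weightSeries_prod h h, ← weightSeries_prod h2 h2,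
    ← weightSeries_prod h3 h3, ← weightSeries_add_one h4.nonneg,
    ← weightSeries_sum (h2.prod h2) ⟨fun p => by have := h4.nonneg p; omega, fun n =>
      (h4.finite_le n).subset fun p hp => by
        simp only [Set.mem_ofPred_eq] at hp ⊢; omega⟩]
  -- Pairs of equal parity rotate to `2a^2 + 2b^2`, pairs of opposite parity to `2(a^2+a) + 2(b^2+b)
  -- + 1`.
  refine (weightSeries_eq_of_bijective (Sum.elim (fun p => (p.1 + p.2, p.1 - p.2))
    fun p => (p.1 + p.2 + 1, p.1 - p.2)) ⟨?_, ?_⟩ ?_).symm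
  · rintro (⟨a, b⟩ | ⟨a, b⟩) (⟨c, d⟩ | ⟨c, d⟩) h <;>
      simp only [Sum.elim_inl, Sum.elim_inr, Prod.mk.injEq] at h
    · congr 2 <;> omega
    · omega
    · omega
    · congr 2 <;> omega
  · rintro ⟨m, n⟩
    rcases Int.emod_two_eq_zero_or_one (m + n) with h | h
    · exact ⟨.inl ((m + n) / 2, (m - n) / 2), by
        simp only [Sum.elim_inl, Prod.mk.injEq]; omega⟩
    · exact ⟨.inr ((m + n) / 2, (m - n) / 2), by
        simp only [Sum.elim_inr, Prod.mk.injEq]; omega⟩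
  · rintro (⟨a, b⟩ | ⟨a, b⟩) <;> simp only [Sum.elim_inl, Sum.elim_inr] <;> ring

/-! ### From coloured F-partitions to charged states -/

namespace ColoredNat

/-- The copy of the nonnegative integers in colour `j`. -/
def withColor {k : ℕ} (j : Fin k) : ℕ ↪ ColoredNat k :=
  ⟨fun x => toLex (x, j), fun _ _ h => congrArg Prod.fst (toLex.injective h)⟩

theorem withColor_apply {k : ℕ} (j : Fin k) (x : ℕ) : withColor j x = toLex (x, j) := rfl

theorem value_withColor {k : ℕ} (j : Fin k) (x : ℕ) : (withColor j x).value = x := rfl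

/-- The finite set of coloured integers with prescribed colour classes. -/
def ofLayers {k : ℕ} (g : Fin k → Finset ℕ) : Finset (ColoredNat k) :=
  Finset.univ.biUnion fun j => (g j).map (withColor j)

theorem mem_ofLayers {k : ℕ} (g : Fin k → Finset ℕ) (x : ℕ) (j : Fin k) :
    (toLex (x, j) : ColoredNat k) ∈ ofLayers g ↔ x ∈ g j := by
  simp [ofLayers, withColor_apply]

theorem sum_ofLayers {k : ℕ} (g : Fin k → Finset ℕ) (f : ℕ → ℤ) :
    ∑ x ∈ ofLayers g, f x.value = ∑ j, ∑ x ∈ g j, f x := by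
  rw [ofLayers, Finset.sum_biUnion]
  · simp [value_withColor]
  · intro i _ j _ hij
    simp only [Function.onFun, Finset.disjoint_left, Finset.mem_map]
    rintro _ ⟨x, _, rfl⟩ ⟨y, _, h⟩
    exact hij (congrArg Prod.snd (toLex.injective h)).symm

theorem card_ofLayers {k : ℕ} (g : Fin k → Finset ℕ) :
    ((ofLayers g).card : ℤ) = ∑ j, ((g j).card : ℤ) := by
  simpa using sum_ofLayers g fun _ => 1

theorem bijective_ofLayers (k : ℕ) : Function.Bijective (ofLayers (k := k)) := by
  constructor
  · intro g g' h
    ext j x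
    rw [← mem_ofLayers, h, mem_ofLayers]
  · intro s
    refine ⟨fun j => s.preimage (withColor j) (withColor j).injective.injOn, ?_⟩
    ext x
    obtain ⟨⟨x, j⟩, rfl⟩ := toLex.surjective x
    rw [mem_ofLayers, Finset.mem_preimage, withColor_apply]

end ColoredNat

namespace FPartition

open ChargedState

/-- The F-partition with the given sets of entries in each colour. -/
def ofStates {k : ℕ} {a : ℚ} {c : ℤ} (hc : c ≠ 0) (ha : a - (k : ℚ) / 2 = c)
    (d : {d : Fin k → ChargedState // ∑ j, (d j).charge = c}) : FPartition k a :=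
  have h : ((ColoredNat.ofLayers fun j => (d.1 j).1).card : ℤ) -
      (ColoredNat.ofLayers fun j => (d.1 j).2).card = c := by
    rw [ColoredNat.card_ofLayers, ColoredNat.card_ofLayers, ← Finset.sum_sub_distrib]
    exact d.2
  { top := (ColoredNat.ofLayers fun j => (d.1 j).1).sort (· ≥ ·)
    bottom := (ColoredNat.ofLayers fun j => (d.1 j).2).sort (· ≥ ·)
    top_decreasing := (Finset.sortedGT_sort _).pairwise
    bottom_decreasing := (Finset.sortedGT_sort _).pairwise
    -- As `r - s = c ≠ 0`, the excluded empty array never arises and needs no correction term.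
    lengths_ne := by
      rw [Finset.length_sort, Finset.length_sort]
      rintro h'
      simp only [Prod.mk.injEq] at h'
      rw [h'.1, h'.2] at h
      exact hc (by simpa using h.symm)
    lengths_sub := by
      rw [Finset.length_sort, Finset.length_sort, ha]
      exact_mod_cast h }

theorem sum_map_sort {α : Type} [LinearOrder α] (s : Finset α) (f : α → ℕ) :
    ((s.sort (· ≥ ·)).map f).sum = ∑ x ∈ s, f x := by
  rw [((Finset.sort_perm_toList s (r := (· ≥ ·))).map f).sum_eq, Finset.sum_map_toList]

theorem weight_ofStates {k : ℕ} {a : ℚ} {c : ℤ} (hc : c ≠ 0) (ha : a - (k : ℚ) / 2 = c)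
    (d : {d : Fin k → ChargedState // ∑ j, (d j).charge = c}) :
    ((ofStates hc ha d).weight : ℤ) = ∑ j, (d.1 j).energy := by
  simp only [weight, ofStates, Finset.length_sort, sum_map_sort, energy]
  push_cast
  rw [ColoredNat.sum_ofLayers _ fun x => (x : ℤ), ColoredNat.sum_ofLayers _ fun x => (x : ℤ),
    ColoredNat.card_ofLayers, ← Finset.sum_add_distrib, ← Finset.sum_add_distrib]
  refine Finset.sum_congr rfl fun j _ => ?_
  rw [Finset.sum_add_distrib, Finset.sum_const, nsmul_eq_mul, mul_one]
  ring

theorem bijective_ofStates {k : ℕ} {a : ℚ} {c : ℤ} (hc : c ≠ 0) (ha : a - (k : ℚ) / 2 = c) :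
    Function.Bijective (ofStates hc ha) := by
  constructor
  · rintro ⟨d, hd⟩ ⟨d', hd'⟩ h
    have h1 := congrArg (fun P => P.top.toFinset) h
    have h2 := congrArg (fun P => P.bottom.toFinset) h
    simp only [ofStates, Finset.sort_toFinset] at h1 h2
    have h1 := (ColoredNat.bijective_ofLayers k).1 h1
    have h2 := (ColoredNat.bijective_ofLayers k).1 h2
    exact Subtype.ext (funext fun j => Prod.ext (congrFun h1 j) (congrFun h2 j))
  · rintro ⟨t, b, ht, hb, hne, hs⟩
    have sort_eq : ∀ l : List (ColoredNat k), l.Pairwise (· > ·) →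
        l.toFinset.sort (· ≥ ·) = l := fun l hl => by
      have hn : l.Nodup := hl.imp fun h => h.ne'
      exact (List.toFinset_sort (· ≥ ·) hn).2 (hl.imp fun h => le_of_lt h)
    have card_eq : ∀ l : List (ColoredNat k), l.Pairwise (· > ·) →
        l.toFinset.card = l.length := fun l hl =>
      List.toFinset_card_of_nodup (hl.imp fun h => h.ne')
    obtain ⟨g, hg⟩ := (ColoredNat.bijective_ofLayers k).2 t.toFinset
    obtain ⟨g', hg'⟩ := (ColoredNat.bijective_ofLayers k).2 b.toFinset
    refine ⟨⟨fun j => (g j, g' j), ?_⟩, ?_⟩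
    · simp only [charge]
      rw [Finset.sum_sub_distrib, ← ColoredNat.card_ofLayers, ← ColoredNat.card_ofLayers, hg, hg',
        card_eq t ht, card_eq b hb]
      rw [ha] at hs
      exact_mod_cast hs
    · simp only [ofStates, hg, hg', sort_eq t ht, sort_eq b hb]

/-- The weight series of coloured F-partitions as a product of neutral series and a theta
series. -/
theorem mk_cpsi {k : ℕ} {a : ℚ} {c : ℤ} (hc : c ≠ 0) (ha : a - (k : ℚ) / 2 = c) :
    PowerSeries.mk (fun n => (cpsi k a n : ℤ)) = neutralSeries ^ k *
      weightSeries fun m : {m : Fin k → ℤ // ∑ j, m j = c} => ∑ j, m.1 j * (m.1 j + 1) / 2 := by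
  have h : PowerSeries.mk (fun n => (cpsi k a n : ℤ)) =
      weightSeries fun P : FPartition k a => (P.weight : ℤ) := by
    ext n
    simp [weightSeries, cpsi]
  have ht := (isProperWeight_mul_succ_ediv_two.pi k).comp_injective
    (Subtype.val_injective (p := fun m : Fin k → ℤ => ∑ j, m j = c))
  rw [h, ← weightSeries_eq_of_bijective _ (bijective_ofStates hc ha) (weight_ofStates hc ha),
    neutralSeries, ← weightSeries_pi isProperWeight_neutral, ← weightSeries_prod
      (isProperWeight_neutral.pi k) ht]
  let F : (Fin k → Neutral) × {m : Fin k → ℤ // ∑ j, m j = c} →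
      {d : Fin k → ChargedState // ∑ j, (d j).charge = c} :=
    fun p => ⟨fun j => lift (p.2.1 j, p.1 j), by simp [charge_lift, p.2.2]⟩
  refine (weightSeries_eq_of_bijective F ⟨?_, ?_⟩ ?_).symm
  · rintro ⟨e, m, hm⟩ ⟨e', m', hm'⟩ h
    have h := fun j => bijective_lift.1 (congrFun (congrArg Subtype.val h) j)
    obtain rfl : e = e' := funext fun j => congrArg Prod.snd (h j)
    obtain rfl : m = m' := funext fun j => congrArg Prod.fst (h j)
    rfl
  · rintro ⟨d, hd⟩
    choose p hp using fun j => bijective_lift.2 (d j)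
    refine ⟨(fun j => (p j).2, ⟨fun j => (p j).1, ?_⟩), ?_⟩
    · rw [← hd]
      exact Finset.sum_congr rfl fun j _ => by rw [← hp, charge_lift]
    · exact Subtype.ext (funext hp)
  · rintro ⟨e, m⟩
    simp only [F, energy_lift, Finset.sum_add_distrib]
    ring

end FPartition

/-! ### The four-variable theta series -/

theorem weightSeries_four_sum_eq_neg_two :
    weightSeries (fun m : {m : Fin 4 → ℤ // ∑ j, m j = -2} => ∑ j, m.1 j * (m.1 j + 1) / 2) =
      2 * expand 2 two_ne_zero (expand 2 two_ne_zero thetaPsi) * thetaPhi ^ 2 +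
      4 * expand 2 two_ne_zero thetaPhi * expand 2 two_ne_zero thetaPsi ^ 2 := by
  have h := isProperWeight_sq
  have h' := isProperWeight_sq_add
  have h2 := h.const_mul (k := 2) (by norm_num)
  have h2' := h'.const_mul (k := 2) (by norm_num)
  have e : 2 * expand 2 two_ne_zero (expand 2 two_ne_zero thetaPsi) * thetaPhi ^ 2 +
      4 * expand 2 two_ne_zero thetaPhi * expand 2 two_ne_zero thetaPsi ^ 2 =
      expand 2 two_ne_zero (2 * expand 2 two_ne_zero thetaPsi) * (thetaPhi * thetaPhi) +
      expand 2 two_ne_zero thetaPhi *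
        ((2 * expand 2 two_ne_zero thetaPsi) * (2 * expand 2 two_ne_zero thetaPsi)) := by
    rw [map_mul, map_ofNat]; ring
  rw [e, ← weightSeries_sq_add, thetaPhi, ← weightSeries_mul_left, ← weightSeries_mul_left,
    Nat.cast_ofNat, ← weightSeries_prod h h, ← weightSeries_prod h' h',
    ← weightSeries_prod h2' (h.prod h), ← weightSeries_prod h2 (h'.prod h'),
    ← weightSeries_sum (h2'.prod (h.prod h)) (h2.prod (h'.prod h'))]
  -- The two summands are the vectors with `m 0 + m 1` even and odd; `m 2 + m 3` then has the same
  -- parity, and each pair is rotated to its half sum and half difference.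
  refine (weightSeries_eq_of_bijective (Sum.elim
    (fun p => ⟨![p.1 + p.2.1, p.1 - p.2.1, -1 - p.1 + p.2.2, -1 - p.1 - p.2.2], by
      simp [Fin.sum_univ_four]; ring⟩)
    fun p => ⟨![p.1 + p.2.1, p.1 - 1 - p.2.1, -p.1 + p.2.2, -p.1 - 1 - p.2.2], by
      simp [Fin.sum_univ_four]; ring⟩) ⟨?_, ?_⟩ ?_).symm
  · rintro (⟨a, b, c⟩ | ⟨a, b, c⟩) (⟨a', b', c'⟩ | ⟨a', b', c'⟩) h <;>
      have h := congrArg Subtype.val h <;>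
      simp only [Sum.elim_inl, Sum.elim_inr, Matrix.vecCons_inj] at h
    · congr 3 <;> omega
    · omega
    · omega
    · congr 3 <;> omega
  · rintro ⟨m, hm⟩
    rw [Fin.sum_univ_four] at hm
    rcases Int.emod_two_eq_zero_or_one (m 0 + m 1) with h | h
    · refine ⟨.inl ((m 0 + m 1) / 2, (m 0 - m 1) / 2, (m 2 - m 3) / 2), Subtype.ext ?_⟩
      ext j
      fin_cases j <;> simp <;> omega
    · refine ⟨.inr ((m 0 + m 1 + 1) / 2, (m 0 - m 1) / 2, (m 2 - m 3) / 2), Subtype.ext ?_⟩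
      ext j
      fin_cases j <;> simp <;> omega
  · have key := Int.two_mul_mul_succ_ediv_two
    rintro (⟨a, b, c⟩ | ⟨a, b, c⟩) <;> refine mul_left_cancel₀ (two_ne_zero (α := ℤ)) ?_ <;>
      simp only [Sum.elim_inl, Sum.elim_inr, Fin.sum_univ_four, mul_add (2 : ℤ), key] <;>
      simp <;> ring

/-- The sum is odd, so exactly one of the pairs `(m 0, m 1)`, `(m 2, m 3)` has even sum; swapping
the pairs gives one factor 2, and the series of `m^2 + m` gives the other. -/
theorem weightSeries_four_sum_eq_neg_one :
    weightSeries (fun m : {m : Fin 4 → ℤ // ∑ j, m j = -1} => ∑ j, m.1 j * (m.1 j + 1) / 2) =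
      4 * (thetaPsi * (thetaPhi * expand 2 two_ne_zero thetaPsi)) := by
  have h := isProperWeight_sq
  have h' := isProperWeight_sq_add
  have h2 := isProperWeight_two_mul_sq_sub
  have e : 4 * (thetaPsi * (thetaPhi * expand 2 two_ne_zero thetaPsi)) =
      thetaPsi * (thetaPhi * (2 * expand 2 two_ne_zero thetaPsi)) +
      thetaPsi * (thetaPhi * (2 * expand 2 two_ne_zero thetaPsi)) := by
    ring
  rw [e, ← weightSeries_sq_add, thetaPhi, thetaPsi, ← weightSeries_prod h h',
    ← weightSeries_prod h2 (h.prod h'),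
    ← weightSeries_sum (h2.prod (h.prod h')) (h2.prod (h.prod h'))]
  refine (weightSeries_eq_of_bijective (Sum.elim
    (fun p => ⟨![-p.1 + p.2.1, -p.1 - p.2.1, p.1 + p.2.2, p.1 - 1 - p.2.2], by
      simp [Fin.sum_univ_four]; ring⟩)
    fun p => ⟨![p.1 + p.2.2, p.1 - 1 - p.2.2, -p.1 + p.2.1, -p.1 - p.2.1], by
      simp [Fin.sum_univ_four]; ring⟩) ⟨?_, ?_⟩ ?_).symm
  · rintro (⟨a, b, c⟩ | ⟨a, b, c⟩) (⟨a', b', c'⟩ | ⟨a', b', c'⟩) h <;>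
      have h := congrArg Subtype.val h <;>
      simp only [Sum.elim_inl, Sum.elim_inr, Matrix.vecCons_inj] at h
    · congr 3 <;> omega
    · omega
    · omega
    · congr 3 <;> omega
  · rintro ⟨m, hm⟩
    rw [Fin.sum_univ_four] at hm
    rcases Int.emod_two_eq_zero_or_one (m 0 + m 1) with h | h
    · refine ⟨.inl (-(m 0 + m 1) / 2, (m 0 - m 1) / 2, (m 2 - m 3) / 2), Subtype.ext ?_⟩
      ext j
      fin_cases j <;> simp <;> omega
    · refine ⟨.inr ((m 0 + m 1 + 1) / 2, (m 2 - m 3) / 2, (m 0 - m 1) / 2), Subtype.ext ?_⟩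
      ext j
      fin_cases j <;> simp <;> omega
  · have key := Int.two_mul_mul_succ_ediv_two
    rintro (⟨a, b, c⟩ | ⟨a, b, c⟩) <;> refine mul_left_cancel₀ (two_ne_zero (α := ℤ)) ?_ <;>
      simp only [Sum.elim_inl, Sum.elim_inr, Fin.sum_univ_four, mul_add (2 : ℤ), key] <;>
      simp <;> ring

/-! ### Parity of coefficients and the 2-dissection -/

theorem even_coeff_sq_of_odd (f : ℤ⟦X⟧) {n : ℕ} (hn : Odd n) : Even (coeff n (f ^ 2)) := by
  obtain ⟨k, rfl⟩ := hn
  -- The swap has no fixed point on pairs with odd sum; `p.1 ≤ k` selects one pair from each orbit.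
  have h : Finset.HasAntidiagonal.antidiagonal (2 * k + 1) =
      (Finset.HasAntidiagonal.antidiagonal (2 * k + 1)).filter (fun p => p.1 ≤ k) ∪
      ((Finset.HasAntidiagonal.antidiagonal (2 * k + 1)).filter (fun p => p.1 ≤ k)).image
        Prod.swap := by
    ext ⟨i, j⟩
    simp only [Finset.HasAntidiagonal.mem_antidiagonal, Finset.mem_union, Finset.mem_filter,
      Finset.mem_image, Prod.exists, Prod.swap_prod_mk, Prod.mk.injEq]
    constructor
    · intro h
      by_cases hi : i ≤ k
      · exact Or.inl ⟨h, hi⟩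
      · exact Or.inr ⟨j, i, ⟨by omega, by omega⟩, rfl, rfl⟩
    · rintro (h | ⟨a, b, h, rfl, rfl⟩) <;> omega
  rw [sq, coeff_mul, h, Finset.sum_union, Finset.sum_image Prod.swap_injective.injOn]
  · exact ⟨_, congrArg₂ _ rfl (Finset.sum_congr rfl fun p _ => mul_comm _ _)⟩
  · rw [Finset.disjoint_left]
    rintro ⟨i, j⟩ h1 h2
    simp only [Finset.HasAntidiagonal.mem_antidiagonal, Finset.mem_filter,
      Finset.mem_image, Prod.exists, Prod.swap_prod_mk, Prod.mk.injEq] at h1 h2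
    obtain ⟨a, b, h, rfl, rfl⟩ := h2
    omega

theorem even_coeff_sq_mul_expand_of_odd (f g : ℤ⟦X⟧) {n : ℕ} (hn : Odd n) :
    Even (coeff n (f ^ 2 * expand 2 two_ne_zero g)) := by
  rw [coeff_mul]
  refine Finset.sum_induction _ _ (fun _ _ => Even.add) Even.zero fun p hp => ?_
  rw [Finset.HasAntidiagonal.mem_antidiagonal] at hp
  rcases Nat.even_or_odd p.2 with h | h
  · refine (even_coeff_sq_of_odd f ?_).mul_right _
    rw [← hp] at hn
    exact (Nat.odd_add.1 hn).2 h
  · rw [coeff_expand_of_not_dvd 2 _ _ (Nat.two_dvd_ne_zero.2 (Nat.odd_iff.1 h)), mul_zero]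
    exact Even.zero

theorem mk_cpsi_four_zero :
    PowerSeries.mk (fun n => (cpsi 4 0 n : ℤ)) =
      expand 2 two_ne_zero (neutralSeries ^ 8 * (thetaPhi * expand 2 two_ne_zero thetaPsi *
        (6 * thetaPhi ^ 4 * expand 2 two_ne_zero thetaPsi +
          32 * X * expand 2 two_ne_zero thetaPsi ^ 5))) +
      32 * (X * expand 2 two_ne_zero ((neutralSeries ^ 4 * thetaPhi * thetaPsi *
        expand 2 two_ne_zero thetaPsi) ^ 2 * expand 2 two_ne_zero thetaPsi)) := by
  have hP := neutralSeries_eq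
  have h1 := thetaPsi_sq
  have h2 := congrArg (expand 2 two_ne_zero) thetaPsi_sq
  have h3 := thetaPhi_sq
  rw [map_pow, map_mul] at h2
  rw [FPartition.mk_cpsi (c := -2) (by norm_num) (by norm_num), weightSeries_four_sum_eq_neg_two]
  simp only [map_mul, map_add, map_pow, map_ofNat, expand_X]
  generalize expand 2 two_ne_zero (expand 2 two_ne_zero thetaPsi) = s4 at *
  generalize expand 2 two_ne_zero thetaPsi = s2 at *
  generalize expand 2 two_ne_zero thetaPhi = f2 at *
  generalize expand 2 two_ne_zero neutralSeries = A at *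
  -- From `P^4 = A^8 ψ^4` and `ψ^4 = φ^2 ψ(q^2)^2`. The only odd power of `q` left is the explicit
  -- `X`.
  have hP4 : neutralSeries ^ 4 = A ^ 8 * ((f2 ^ 2 + 4 * X * s4 ^ 2) * (f2 * s4)) := by
    rw [← h3, ← h2, ← mul_pow, ← h1, hP]
    ring
  -- The product is `A^8 f2 s4 (f2^2 + 4X s4^2)(6 f2^2 s4 + 8X s4^3)`; its term linear in the
  -- explicit `X` has coefficient `8 + 24 = 32`.
  rw [hP4, h3, mul_pow _ s4, mul_pow _ s2, h2]
  ring

theorem cpsi_four_zero_odd (n : ℕ) : (cpsi 4 0 (2 * n + 1) : ℤ) =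
    32 * coeff n ((neutralSeries ^ 4 * thetaPhi * thetaPsi * expand 2 two_ne_zero thetaPsi) ^ 2 *
      expand 2 two_ne_zero thetaPsi) := by
  have h := congrArg (coeff (2 * n + 1)) mk_cpsi_four_zero
  rw [coeff_mk, map_add, coeff_expand_of_not_dvd 2 _ _ (by omega), zero_add,
    show (32 : ℤ⟦X⟧) = C (32 : ℤ) from rfl, coeff_C_mul, coeff_succ_X_mul, coeff_expand_mul] at h
  exact h

theorem mainTheorem7 :
    (∀ n : ℕ, cpsi 4 0 (2 * n + 1) ≡ 0 [MOD 32]) ∧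
    (∀ n : ℕ, cpsi 4 0 (4 * n + 3) ≡ 0 [MOD 64]) ∧
    (∀ n : ℕ, cpsi 4 1 n ≡ 0 [MOD 4]) := by
  refine ⟨fun n => ?_, fun n => ?_, fun n => ?_⟩ <;>
    refine Nat.modEq_zero_iff_dvd.2 (Int.natCast_dvd_natCast.1 ?_)
  · exact ⟨_, cpsi_four_zero_odd n⟩
  · rw [show 4 * n + 3 = 2 * (2 * n + 1) + 1 by ring, cpsi_four_zero_odd]
    exact mul_dvd_mul (a := (32 : ℤ)) (b := 32) (c := 2) dvd_rfl
      (even_coeff_sq_mul_expand_of_odd _ _ ⟨n, rfl⟩).two_dvd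
  · have h := congrArg (coeff n) (FPartition.mk_cpsi (k := 4) (a := 1) (c := -1) (by norm_num)
      (by norm_num))
    rw [weightSeries_four_sum_eq_neg_one, mul_left_comm, coeff_mk,
      show (4 : ℤ⟦X⟧) = C (4 : ℤ) from rfl, coeff_C_mul] at h
    exact ⟨_, h⟩
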